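/- Let $\mathrm{FI}$ be the category whose objects are the finite sets $[n]=\{1,\dots,n\}$, $n\ge 0$, and whose morphisms are injections. A graph is a finite simple graph (no loops, no multiple edges, possibly disconnected or empty), with vertex set $V(G)$ and edge set $E(G)$; a homomorphism of graphs $G\to G'$ is a map $\phi:V(G)\to V(G')$ such that $\{\phi(x),\phi(y)\}\in E(G')$ whenever $\{x,y\}\in E(G)$. An $\mathrm{FI}$-graph $G_\bullet$ is a functor from $\mathrm{FI}$ to the category of graphs and graph homomorphisms; write $G_n$ for its value on $[n]$. For an injection $f:[n]\hookrightarrow[m]$, the induced homomorphism $G(f):G_n\to G_m$ is called a transition map. The image of $G(f)$ is the subgraph of $G_m$ whose vertices and edges are the images of the vertices and edges of $G_n$. A subgraph $G'$ of a graph $G$ is induced if every edge of $G$ between two vertices of $G'$ is an edge of $G'$. Call $G_\bullet$ vertex-stable if there is $d\ge 0$ such that for every $n\ge d$ and every $v\in V(G_{n+1})$ there exist $w\in V(G_n)$ and an injection $f:[n]\hookrightarrow[n+1]$ with $G(f)(w)=v$. **Theorem.** Let $G_\bullet$ be a vertex-stable $\mathrm{FI}$-graph. Then: 1. for every $r\ge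 1$, $G_\bullet$ is $r$-vertex-stable: there is $N$ (depending on $r$ and $G_\bullet$) such that for every $n\ge N$ and any $r$ distinct vertices $x_1,\dots,x_r$ of $G_{n+1}$ there exist vertices $v_1,\dots,v_r$ of $G_n$ and a single injection $f:[n]\hookrightarrow[n+1]$ with $G(f)(v_i)=x_i$ for all $i$; 2. $G_\bullet$ is edge-stable: there is $k\ge 0$ such that for every $n\ge k$ and every edge $\{x,y\}\in E(G_n)$ there exist an edge $\{v,w\}\in E(G_k)$ and an injection $f:[k]\hookrightarrow[n]$ with $G(f)(v)=x$ and $G(f)(w)=y$; 3. $G_\bullet$ is eventually injective and eventually induced: there is $N$ such that for all $n\ge N$, all $m$, and all injections $f:[n]\hookrightarrow[m]$, the transition map $G(f)$ is injective on vertices; and there is $N'$ such that for all $n\ge N'$, all $m$, and all injections $f:[n]\hookrightarrow[m]$, the image of $G(f)$ is an induced subgraph of $G_m$. -/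

import Mathlib

open CategoryTheory

/-- The category `FI`: its objects are the finite sets `[n]`, one for each natural number `n`
(modelled as `Fin n`), and its morphisms are the injections. -/
structure FI where
  /-- The number `n` of elements of the object `[n]`. -/
  card : ℕ

instance FI.instCategory : Category FI where
  Hom X Y := Fin X.card ↪ Fin Y.card
  id X := Function.Embedding.refl (Fin X.card)
  comp f g := f.trans g

universe u

/-- A finite simple graph: no loops, no multiple edges, finitely many vertices; it may be
disconnected or empty. -/
structure FinSimpleGraph : Type (u + 1) where
  /-- The vertex set. -/
  V : Type u
  [finite : Finite V]
  /-- The edges. -/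
  graph : SimpleGraph V

attribute [instance] FinSimpleGraph.finite

/-- The category of finite simple graphs and graph homomorphisms (edges go to edges, hence
adjacent vertices have distinct images). -/
instance FinSimpleGraph.instCategory : Category FinSimpleGraph.{u} where
  Hom G H := G.graph →g H.graph
  id G := SimpleGraph.Hom.id
  comp f g := g.comp f

/-- An `FI`-graph is a functor from `FI` to the category of finite simple graphs. -/
abbrev FIGraph : Type (u + 1) := FI ⥤ FinSimpleGraph.{u}

namespace FIGraph

/-- The vertex set of the graph `G_n`. -/
abbrev Vert (G : FIGraph.{u}) (n : ℕ) : Type u := (G.obj ⟨n⟩).V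

/-- The graph `G_n`. -/
abbrev graph (G : FIGraph.{u}) (n : ℕ) : SimpleGraph (G.Vert n) := (G.obj ⟨n⟩).graph

/-- The transition map `G(f) : G_n → G_m` induced by an injection `f : [n] ↪ [m]`. -/
def transition (G : FIGraph.{u}) {n m : ℕ} (f : Fin n ↪ Fin m) : G.graph n →g G.graph m :=
  G.map (X := (⟨n⟩ : FI)) (Y := (⟨m⟩ : FI)) f

/-- `G` is vertex-stable with stable degree `≤ d`: for every `n ≥ d`, every vertex of `G_{n+1}`
is the image of a vertex of `G_n` under some transition map. -/
def VertexStableWith (G : FIGraph.{u}) (d : ℕ) : Prop :=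
  ∀ n, d ≤ n → ∀ v : G.Vert (n + 1),
    ∃ (w : G.Vert n) (f : Fin n ↪ Fin (n + 1)), G.transition f w = v

/-- `G` is vertex-stable. -/
def VertexStable (G : FIGraph.{u}) : Prop := ∃ d : ℕ, G.VertexStableWith d

/-- `G` is `r`-vertex-stable: for all large `n`, any `r` (distinct) vertices of `G_{n+1}` are the
images of `r` vertices of `G_n` under a single transition map. The vertices `v i` are
then distinct too. -/
def RVertexStable (G : FIGraph.{u}) (r : ℕ) : Prop :=
  ∃ N : ℕ, ∀ n, N ≤ n → ∀ x : Fin r → G.Vert (n + 1), Function.Injective x →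
    ∃ (v : Fin r → G.Vert n) (f : Fin n ↪ Fin (n + 1)), ∀ i, G.transition f (v i) = x i

/-- `G` is edge-stable with edge-stable degree `≤ k`: for every `n ≥ k`, every edge of `G_n` is the
image of an edge of `G_k` under some transition map. -/
def EdgeStableWith (G : FIGraph.{u}) (k : ℕ) : Prop :=
  ∀ n, k ≤ n → ∀ x y : G.Vert n, (G.graph n).Adj x y →
    ∃ (v w : G.Vert k) (f : Fin k ↪ Fin n), (G.graph k).Adj v w ∧
      G.transition f v = x ∧ G.transition f w = y

/-- `G` is edge-stable. -/
def EdgeStable (G : FIGraph.{u}) : Prop := ∃ k : ℕ, G.EdgeStableWith k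

/-- `G` is eventually injective: for all large `n`, every transition map originating from `G_n`
is injective. -/
def EventuallyInjective (G : FIGraph.{u}) : Prop :=
  ∃ N : ℕ, ∀ n, N ≤ n → ∀ (m : ℕ) (f : Fin n ↪ Fin m), Function.Injective (G.transition f)

/-- The image of a transition map, as a subgraph of its target: its vertices are the images of
the vertices and its edges are the images of the edges. -/
def imageSubgraph (G : FIGraph.{u}) {n m : ℕ} (f : Fin n ↪ Fin m) : (G.graph m).Subgraph :=
  SimpleGraph.Subgraph.map (G.transition f) ⊤

/-- `G` is eventually induced: for all large `n`, the image of every transition map originating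
from `G_n` is an induced subgraph of the target. -/
def EventuallyInduced (G : FIGraph.{u}) : Prop :=
  ∃ N : ℕ, ∀ n, N ≤ n → ∀ (m : ℕ) (f : Fin n ↪ Fin m), (G.imageSubgraph f).IsInduced

end FIGraph

/-!
Write `f_* v` for the value of the transition map of `f` at `v`. Vertex-stability in degree `d`
means that every vertex of `G_n`, `n ≥ d`, has the form `f_* w` with `w` in `G_d` and
`f : [d] ↪ [n]`. The images of `r` such injections together have at most `r * d` elements, so `r`
vertices of `G_n` always come from any `G_k` with `r * d ≤ k ≤ n` along a single injection
(`FIGraph.VertexStableWith.exists_common_transition`); the case `n = k + 1` is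
`r`-vertex-stability.

The other assertions concern relations `R_n` on the vertices of `G_n` which the transition maps
preserve: equality and adjacency. For a fixed pair `v, w` of vertices of `G_k`, whether
`R_n (h_* v) (h_* w)` holds does not depend on `h : [k] ↪ [n]`, because any two such `h` differ by
a permutation of `[n]`; and once it holds for some `n` it holds for all larger ones. As `G_k` has
only finitely many pairs of vertices, all these truth values are constant from some `N` on. For
`k = 2 * d ≤ n` every pair of vertices of `G_n` arises in this way, so the transition maps out of
`G_n`, `n ≥ N`, reflect `R` (`FIGraph.VertexStableWith.eventually_reflects`). For equality this is
eventual injectivity; for adjacency it gives both eventual inducedness and edge-stability.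
-/

/-! ### Injections between the sets `[n]` -/

/-- The symmetric group of `[n]` acts transitively on the injections `[k] ↪ [n]`. -/
theorem Fin.exists_perm_comp_embedding {k n : ℕ} (f g : Fin k ↪ Fin n) :
    ∃ σ : Fin n ↪ Fin n, f.trans σ = g := by
  obtain ⟨σ, hσ⟩ := Equiv.Perm.exists_smul_eq_embedding f g
  exact ⟨σ.toEmbedding, by rw [← hσ]; rfl⟩

/-- If a finite family of injections `[d] ↪ [n]` has few enough members, all of them factor through
one injection `[k] ↪ [n]`. -/
theorem Fin.exists_common_factor {ι : Type*} [Fintype ι] {d k n : ℕ}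
    (hk : Fintype.card ι * d ≤ k) (hkn : k ≤ n) (f : ι → Fin d ↪ Fin n) :
    ∃ (h : Fin k ↪ Fin n) (g : ι → Fin d ↪ Fin k), ∀ i, (g i).trans h = f i := by
  classical
  have hcard : (Finset.univ.biUnion fun i => Finset.univ.map (f i)).card ≤ k := by
    refine (Finset.card_biUnion_le_card_mul _ _ d fun i _ => ?_).trans hk
    simp
  obtain ⟨s, hs, hsk⟩ := Finset.exists_superset_card_eq hcard (by simpa using hkn)
  have hmem (i : ι) (a : Fin d) : f i a ∈ s :=
    hs (Finset.mem_biUnion.2 ⟨i, Finset.mem_univ i, Finset.mem_map_of_mem _ (Finset.mem_univ a)⟩)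
  let e := s.orderIsoOfFin hsk
  refine ⟨(s.orderEmbOfFin hsk).toEmbedding,
    fun i => ⟨fun a => e.symm ⟨f i a, hmem i a⟩, fun a b hab => ?_⟩, fun i => ?_⟩
  · simpa using hab
  · ext a
    change ((e (e.symm ⟨f i a, hmem i a⟩) : Fin n) : ℕ) = f i a
    simp

namespace FIGraph

variable {G : FIGraph.{u}} {d : ℕ}

theorem transition_trans {l m n : ℕ} (f : Fin l ↪ Fin m) (g : Fin m ↪ Fin n) (v : G.Vert l) :
    G.transition (f.trans g) v = G.transition g (G.transition f v) :=
  congrArg (fun φ : G.graph l →g G.graph n => φ v)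
    (G.map_comp (X := (⟨l⟩ : FI)) (Y := (⟨m⟩ : FI)) (Z := (⟨n⟩ : FI)) f g)

theorem transition_refl {n : ℕ} (v : G.Vert n) :
    G.transition (Function.Embedding.refl (Fin n)) v = v :=
  congrArg (fun φ : G.graph n →g G.graph n => φ v) (G.map_id (⟨n⟩ : FI))

/-! ### Lifting vertices along a single injection -/

theorem VertexStableWith.exists_transition (hG : G.VertexStableWith d) {n : ℕ} (hn : d ≤ n)
    (v : G.Vert n) : ∃ (w : G.Vert d) (f : Fin d ↪ Fin n), G.transition f w = v := by
  induction n, hn using Nat.le_induction with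
  | base => exact ⟨v, Function.Embedding.refl _, transition_refl v⟩
  | succ n hn ih =>
    obtain ⟨w, f, rfl⟩ := hG n hn v
    obtain ⟨w, g, rfl⟩ := ih w
    exact ⟨w, g.trans f, transition_trans g f w⟩

theorem VertexStableWith.exists_common_transition (hG : G.VertexStableWith d) {ι : Type*}
    [Fintype ι] {k n : ℕ} (hd : d ≤ n) (hk : Fintype.card ι * d ≤ k) (hkn : k ≤ n)
    (x : ι → G.Vert n) :
    ∃ (v : ι → G.Vert k) (h : Fin k ↪ Fin n), ∀ i, G.transition h (v i) = x i := by
  choose w f hf using fun i => hG.exists_transition hd (x i)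
  obtain ⟨h, g, hg⟩ := Fin.exists_common_factor hk hkn f
  exact ⟨fun i => G.transition (g i) (w i), h, fun i => by rw [← transition_trans, hg, hf]⟩

theorem VertexStableWith.exists_common_transition_pair (hG : G.VertexStableWith d) {k n : ℕ}
    (hk : 2 * d ≤ k) (hkn : k ≤ n) (x y : G.Vert n) :
    ∃ (v w : G.Vert k) (h : Fin k ↪ Fin n), G.transition h v = x ∧ G.transition h w = y := by
  obtain ⟨v, h, hv⟩ := hG.exists_common_transition (ι := Fin 2) (by omega) (by simpa using hk) hkn
    ![x, y]
  exact ⟨v 0, v 1, h, hv 0, hv 1⟩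

/-! ### Relations preserved by the transition maps -/

/-- Transition maps out of large degrees reflect every relation that all transition maps
preserve. -/
theorem VertexStableWith.eventually_reflects (hG : G.VertexStableWith d)
    (R : ∀ n, G.Vert n → G.Vert n → Prop)
    (hR : ∀ {n m : ℕ} (f : Fin n ↪ Fin m) (v w : G.Vert n), R n v w →
      R m (G.transition f v) (G.transition f w)) :
    ∃ N, ∀ n, N ≤ n → ∀ (m : ℕ) (f : Fin n ↪ Fin m) (v w : G.Vert n),
      R m (G.transition f v) (G.transition f w) → R n v w := by
  -- `b p` is a degree in which the pair `p` has become related, if there is one.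
  have hb (p : G.Vert (2 * d) × G.Vert (2 * d)) : ∃ b : ℕ,
      ∀ (m : ℕ) (h : Fin (2 * d) ↪ Fin m), R m (G.transition h p.1) (G.transition h p.2) →
        ∃ h₀ : Fin (2 * d) ↪ Fin b, R b (G.transition h₀ p.1) (G.transition h₀ p.2) := by
    by_cases H : ∃ (b : ℕ) (h₀ : Fin (2 * d) ↪ Fin b),
        R b (G.transition h₀ p.1) (G.transition h₀ p.2)
    · exact ⟨H.choose, fun _ _ _ => H.choose_spec⟩
    · exact ⟨0, fun m h hm => (H ⟨m, h, hm⟩).elim⟩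
  choose b hb using hb
  obtain ⟨B, hB⟩ := (Set.finite_range b).bddAbove
  refine ⟨max B (2 * d), fun n hn m f x y hxy => ?_⟩
  obtain ⟨v, w, h, rfl, rfl⟩ := hG.exists_common_transition_pair le_rfl
    ((le_max_right _ _).trans hn) x y
  rw [← transition_trans, ← transition_trans] at hxy
  obtain ⟨h₀, h₀R⟩ := hb (v, w) m _ hxy
  have hbn : b (v, w) ≤ n := (hB ⟨_, rfl⟩).trans ((le_max_left _ _).trans hn)
  obtain ⟨σ, hσ⟩ := Fin.exists_perm_comp_embedding (h₀.trans (Fin.castLEEmb hbn)) h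
  rw [← hσ, transition_trans, transition_trans, transition_trans, transition_trans]
  exact hR σ _ _ (hR _ _ _ h₀R)

theorem VertexStableWith.eventually_reflects_adj (hG : G.VertexStableWith d) :
    ∃ N, ∀ n, N ≤ n → ∀ (m : ℕ) (f : Fin n ↪ Fin m) (v w : G.Vert n),
      (G.graph m).Adj (G.transition f v) (G.transition f w) → (G.graph n).Adj v w :=
  hG.eventually_reflects (fun n => (G.graph n).Adj) fun f _ _ h => (G.transition f).map_adj h

/-! ### The stability properties -/

theorem VertexStableWith.rVertexStable (hG : G.VertexStableWith d) (r : ℕ) :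
    G.RVertexStable r :=
  ⟨max d (r * d), fun n hn x _ => hG.exists_common_transition (by omega)
    (by simpa using (le_max_right _ _).trans hn) n.le_succ x⟩

theorem VertexStableWith.edgeStable (hG : G.VertexStableWith d) : G.EdgeStable := by
  obtain ⟨N, hN⟩ := hG.eventually_reflects_adj
  refine ⟨max N (2 * d), fun n hn x y hxy => ?_⟩
  obtain ⟨v, w, h, rfl, rfl⟩ := hG.exists_common_transition_pair (le_max_right N _) hn x y
  exact ⟨v, w, h, hN _ (le_max_left _ _) n h v w hxy, rfl, rfl⟩

theorem VertexStableWith.eventuallyInjective (hG : G.VertexStableWith d) :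
    G.EventuallyInjective := by
  obtain ⟨N, hN⟩ := hG.eventually_reflects (fun _ v w => v = w) fun f v w h => by rw [h]
  exact ⟨N, fun n hn m f v w h => hN n hn m f v w h⟩

theorem VertexStableWith.eventuallyInduced (hG : G.VertexStableWith d) :
    G.EventuallyInduced := by
  obtain ⟨N, hN⟩ := hG.eventually_reflects_adj
  refine ⟨N, fun n hn m f => ?_⟩
  rintro _ ⟨v, -, rfl⟩ _ ⟨w, -, rfl⟩ hvw
  exact ⟨v, w, hN n hn m f v w hvw, rfl, rfl⟩

end FIGraph

theorem mainTheorem1 (G : FIGraph.{u}) (hG : G.VertexStable) :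
    (∀ r : ℕ, 1 ≤ r → G.RVertexStable r) ∧
      G.EdgeStable ∧
      G.EventuallyInjective ∧
      G.EventuallyInduced := by
  obtain ⟨d, hd⟩ := hG
  exact ⟨fun r _ => hd.rVertexStable r, hd.edgeStable, hd.eventuallyInjective,
    hd.eventuallyInduced⟩
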